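/- Let $\mathcal T$ be either the category of non-empty topological spaces and continuous maps (with free homotopies), or the category of well-pointed spaces (the inclusion of the basepoint is a closed cofibration) and basepoint-preserving maps (with pointed homotopies). A \emph{sectional category} on $\mathcal T$ is an assignment of a value $\mathrm{secat}(\iota)\in\mathbb N\cup\{\infty\}$ to every map $\iota\colon A\to Y$ of $\mathcal T$ such that (S0) $\mathrm{secat}(\iota)=0$ if and only if there is a map $s\colon Y\to A$ with $\iota\circ s\simeq \mathrm{id}_Y$; (S1) if $\iota\colon A\to X$, $\kappa\colon B\to X$, $\zeta\colon B\to A$ satisfy $\iota\circ\zeta\simeq\kappa$, then $\mathrm{secat}(\iota)\le\mathrm{secat}(\kappa)$; (S2) if a square with sides $q\colon P\to X$, $p\colon P\to A$, $f\colon X\to Y$, $\iota\colon A\to Y$ is a homotopy pullback in $\mathcal T$, then $\mathrm{secat}(q)\le \mathrm{secat}(\iota)$. Given such a $\mathrm{secat}$, the lifting category of $f\colon X\to Y$ and $\iota\colon A\to Y$ is $\mathrm{liftcat}_f(\iota)=\mathrm{secat}(q)$, where $q\colon P\to X$ belongs to any homotopy pullback $P$ of $f$ and $\iota$ in $\mathcal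 T$ (and $\infty$ if there is none in $\mathcal T$). With $\Delta\colon Y\to Y\times Y$ the diagonal, put $D(f,g)=\mathrm{liftcat}_{(f,g)}(\Delta)$ for $f,g\colon X\to Y$, $\mathrm{TC}(Y)=\mathrm{secat}(\Delta)$, and, for $Y$ path-connected, $\mathrm{cat}(Y)=\mathrm{liftcat}_{\mathrm{id}_Y}(c)$ for any constant map $c\colon *\to Y$ (in the pointed setting $c$ is the inclusion of the basepoint, and path-connectedness is not needed). Let $X$ be a space of $\mathcal T$, path-connected in the unpointed setting, and let $n_X\colon X\to X$ be a constant map of $\mathcal T$. Then, for every sectional category on $\mathcal T$ and every choice of the constant maps that define $\mathrm{cat}(X)$ and $\mathrm{cat}(X\times X)$, $$D(\mathrm{id}_X,n_X)=\mathrm{cat}(X)\le \mathrm{TC}(X)\le \mathrm{cat}(X\times X).$$ The same holds for the open-cover versions of these invariants, in which $\mathrm{liftcat}_f(\iota)$ is the least $n$ such that $X$ has an open cover $U_0,\dots,U_n$ (each $U_i$ containing the basepoint in the pointed setting) with maps $l_i\colon U_i\to A$ of $\mathcal T$ satisfying $\iota\circ l_i\simeq f|_{U_i}$ for all $i$ (and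 $\infty$ if there is no such $n$), and $\mathrm{secat}(\iota)=\mathrm{liftcat}_{\mathrm{id}_Y}(\iota)$. -/

import Mathlib

open scoped unitInterval

universe u

/-! ### The unpointed setting: non-empty topological spaces and continuous maps -/

namespace UnptLift

section HomotopyPullback

variable {P X A Y : Type u} [TopologicalSpace P] [TopologicalSpace X] [TopologicalSpace A]
  [TopologicalSpace Y]

/-- The standard homotopy pullback of `f : X → Y` and `ι : A → Y`: triples `(x, γ, a)` where `γ` is
a path in `Y` from `f x` to `ι a`, with the compact-open topology on paths. -/
abbrev StdPullback (f : C(X, Y)) (ι : C(A, Y)) : Type u :=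
  {w : X × C(I, Y) × A // w.2.1 0 = f w.1 ∧ w.2.1 1 = ι w.2.2}

/-- The square with sides `q : P → X`, `p : P → A`, `f : X → Y`, `ι : A → Y` is a homotopy pullback:
it commutes up to some homotopy `f ∘ q ≃ ι ∘ p` such that the induced map `w` from `P` to the
standard homotopy pullback is a homotopy equivalence. (A map `w` whose outer coordinates are `q`
and `p` is the same thing as such a homotopy, namely its path coordinate.) -/
def IsHomotopyPullback (q : C(P, X)) (p : C(P, A)) (f : C(X, Y)) (ι : C(A, Y)) : Prop :=
  ∃ w : C(P, StdPullback f ι),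
    (∀ z, (w z).1.1 = q z) ∧ (∀ z, (w z).1.2.2 = p z) ∧
    ∃ v : C(StdPullback f ι, P),
      (v.comp w).Homotopic (ContinuousMap.id P) ∧
      (w.comp v).Homotopic (ContinuousMap.id (StdPullback f ι))

end HomotopyPullback

/-- An abstract sectional category: an integer or `∞` attached to every continuous map between
non-empty spaces, subject to the three axioms S0, S1, S2. (Its values on maps from or to an empty
space are unconstrained and never used.) -/
structure SectionalCategory where
  /-- the sectional category of a map -/
  secat : ∀ {A Y : Type u} [TopologicalSpace A] [TopologicalSpace Y], C(A, Y) → ℕ∞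
  /-- S0: `secat ι = 0` iff `ι` has a homotopy section. -/
  S0 : ∀ {A Y : Type u} [TopologicalSpace A] [TopologicalSpace Y] [Nonempty A] [Nonempty Y]
    (ι : C(A, Y)),
    secat ι = 0 ↔ ∃ s : C(Y, A), (ι.comp s).Homotopic (ContinuousMap.id Y)
  /-- S1: if `κ ≃ ι ∘ ζ` then `secat ι ≤ secat κ`. -/
  S1 : ∀ {A B X : Type u} [TopologicalSpace A] [TopologicalSpace B] [TopologicalSpace X]
    [Nonempty A] [Nonempty B] [Nonempty X] (ι : C(A, X)) (κ : C(B, X)) (ζ : C(B, A)),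
    (ι.comp ζ).Homotopic κ → secat ι ≤ secat κ
  /-- S2: `secat` does not increase under homotopy pullback. -/
  S2 : ∀ {P X A Y : Type u} [TopologicalSpace P] [TopologicalSpace X] [TopologicalSpace A]
    [TopologicalSpace Y] [Nonempty P] [Nonempty X] [Nonempty A] [Nonempty Y]
    (q : C(P, X)) (p : C(P, A)) (f : C(X, Y)) (ι : C(A, Y)),
    IsHomotopyPullback q p f ι → secat q ≤ secat ι

variable {X Y A : Type u} [TopologicalSpace X] [TopologicalSpace Y] [TopologicalSpace A]

/-- The diagonal map. -/
def diag (Y : Type u) [TopologicalSpace Y] : C(Y, Y × Y) :=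
  (ContinuousMap.id Y).prodMk (ContinuousMap.id Y)

/-- The constant map `* → Y` with value `y₀`. -/
def pointMap (y₀ : Y) : C(PUnit.{u + 1}, Y) := ContinuousMap.const _ y₀

namespace SectionalCategory

variable (S : SectionalCategory.{u})

/-- The lifting category from `f` to `ι`: the sectional category of `q : P → X`, where `P` is a
homotopy pullback of `f` and `ι`. By S1 all choices of `P` give the same value, so the set
below has at most one element; it is empty, and the value is `∞`, only if the homotopy pullback
is the empty space. -/
noncomputable def liftcat (f : C(X, Y)) (ι : C(A, Y)) : ℕ∞ :=
  sInf {m | ∃ (P : Type u) (_ : TopologicalSpace P) (_ : Nonempty P) (q : C(P, X)) (p : C(P, A)),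
    IsHomotopyPullback q p f ι ∧ S.secat q = m}

/-- The homotopic distance `D(f, g)`. -/
noncomputable def dist (f g : C(X, Y)) : ℕ∞ := S.liftcat (f.prodMk g) (diag Y)

/-- The topological complexity. -/
noncomputable def TC (Y : Type u) [TopologicalSpace Y] : ℕ∞ := S.secat (diag Y)

/-- The category of a map `f : X → Y`, computed with the constant map `* → Y` at `y₀`. -/
noncomputable def catMap (f : C(X, Y)) (y₀ : Y) : ℕ∞ := S.liftcat f (pointMap y₀)

/-- The LS category of `Y`, computed with the constant map `* → Y` at `y₀`. -/
noncomputable def cat (Y : Type u) [TopologicalSpace Y] (y₀ : Y) : ℕ∞ :=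
  S.catMap (ContinuousMap.id Y) y₀

end SectionalCategory

/-! The version with open covers. -/

/-- There is a categorical open cover of `X` by `n + 1` open sets for `f` and `ι`. -/
def HasCatCover (f : C(X, Y)) (ι : C(A, Y)) (n : ℕ) : Prop :=
  ∃ U : Fin (n + 1) → Set X, (∀ i, IsOpen (U i)) ∧ (∀ x, ∃ i, x ∈ U i) ∧
    ∀ i, ∃ l : C(U i, A), (ι.comp l).Homotopic (f.restrict (U i))

/-- The lifting category with open covers: the least `n` with a categorical cover by `n + 1` open
sets, and `∞` if there is none. -/
noncomputable def liftcatOp (f : C(X, Y)) (ι : C(A, Y)) : ℕ∞ :=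
  sInf {m | ∃ n : ℕ, HasCatCover f ι n ∧ (n : ℕ∞) = m}

/-- The sectional category with open covers. -/
noncomputable def secatOp (ι : C(A, Y)) : ℕ∞ := liftcatOp (ContinuousMap.id Y) ι

/-- The homotopic distance with open covers. -/
noncomputable def distOp (f g : C(X, Y)) : ℕ∞ := liftcatOp (f.prodMk g) (diag Y)

/-- The topological complexity with open covers. -/
noncomputable def TCOp (Y : Type u) [TopologicalSpace Y] : ℕ∞ := secatOp (diag Y)

/-- The LS category with open covers, computed with the constant map `* → Y` at `y₀`. -/
noncomputable def catOp (Y : Type u) [TopologicalSpace Y] (y₀ : Y) : ℕ∞ :=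
  liftcatOp (ContinuousMap.id Y) (pointMap y₀)

end UnptLift

/-! ### The pointed setting: well-pointed spaces and basepoint-preserving maps -/

/-- A topological space with a basepoint. -/
structure PtSpace : Type (u + 1) where
  /-- the underlying type -/
  carrier : Type u
  [top : TopologicalSpace carrier]
  /-- the basepoint -/
  pt : carrier

namespace PtSpace

instance : CoeSort PtSpace.{u} (Type u) := ⟨PtSpace.carrier⟩

instance (X : PtSpace.{u}) : TopologicalSpace X := X.top

/-- `X` is well-pointed: the inclusion of the basepoint is a closed cofibration, i.e. the basepoint
is closed and its inclusion has the homotopy extension property. -/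
def WellPointed (X : PtSpace.{u}) : Prop :=
  IsClosed ({X.pt} : Set X) ∧
  ∀ (Z : Type u) [TopologicalSpace Z] (f : C(X, Z)) (γ : C(I, Z)), γ 0 = f X.pt →
    ∃ H : C(I × X, Z), (∀ x, H (0, x) = f x) ∧ ∀ t, H (t, X.pt) = γ t

/-- Continuous maps preserving basepoints. -/
structure Map (X Y : PtSpace.{u}) where
  /-- the underlying continuous map -/
  toCont : C(X, Y)
  map_pt : toCont X.pt = Y.pt

/-- The identity. -/
def Map.id (X : PtSpace.{u}) : Map X X := ⟨ContinuousMap.id X, rfl⟩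

/-- Composition. -/
def Map.comp {X Y Z : PtSpace.{u}} (g : Map Y Z) (f : Map X Y) : Map X Z :=
  ⟨g.toCont.comp f.toCont, by simp [f.map_pt, g.map_pt]⟩

/-- Pointed homotopy. -/
def Map.Homotopic {X Y : PtSpace.{u}} (f g : Map X Y) : Prop :=
  f.toCont.HomotopicRel g.toCont {X.pt}

/-- The product of pointed spaces. -/
def prod (X Y : PtSpace.{u}) : PtSpace.{u} := ⟨X × Y, (X.pt, Y.pt)⟩

/-- The map `(f, g)` into a product. -/
def Map.pair {X Y Z : PtSpace.{u}} (f : Map X Y) (g : Map X Z) : Map X (Y.prod Z) :=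
  ⟨f.toCont.prodMk g.toCont, Prod.ext f.map_pt g.map_pt⟩

/-- The diagonal map. -/
def diag (Y : PtSpace.{u}) : Map Y (Y.prod Y) := Map.pair (Map.id Y) (Map.id Y)

/-- The one-point space. -/
def point : PtSpace.{u} := ⟨PUnit.{u + 1}, PUnit.unit⟩

/-- The constant map `X → Y` in the pointed setting. -/
def const (X Y : PtSpace.{u}) : Map X Y := ⟨ContinuousMap.const X Y.pt, rfl⟩

/-- An open (or arbitrary) subset containing the basepoint, as a pointed space. -/
def sub (X : PtSpace.{u}) (U : Set X) (hU : X.pt ∈ U) : PtSpace.{u} := ⟨U, ⟨X.pt, hU⟩⟩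

/-- The restriction of a map to a subset containing the basepoint. -/
def Map.restrict {X Y : PtSpace.{u}} (f : Map X Y) (U : Set X) (hU : X.pt ∈ U) :
    Map (X.sub U hU) Y :=
  ⟨f.toCont.restrict U, f.map_pt⟩

/-- The standard homotopy pullback, pointed by the constant path at the basepoint. -/
def stdPullback {X A Y : PtSpace.{u}} (f : Map X Y) (ι : Map A Y) : PtSpace.{u} :=
  ⟨UnptLift.StdPullback f.toCont ι.toCont,
    ⟨(X.pt, ContinuousMap.const I Y.pt, A.pt), f.map_pt.symm, ι.map_pt.symm⟩⟩

/-- Homotopy pullback squares in the pointed setting: `w` is the map from `P` to the standard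
homotopy pullback induced by a pointed homotopy `f ∘ q ≃ ι ∘ p` (its path coordinate), and it has
to be a pointed homotopy equivalence. -/
def IsHomotopyPullback {P X A Y : PtSpace.{u}} (q : Map P X) (p : Map P A) (f : Map X Y)
    (ι : Map A Y) : Prop :=
  ∃ w : Map P (stdPullback f ι),
    (∀ z, (w.toCont z).1.1 = q.toCont z) ∧ (∀ z, (w.toCont z).1.2.2 = p.toCont z) ∧
    ∃ v : Map (stdPullback f ι) P,
      (v.comp w).Homotopic (Map.id P) ∧ (w.comp v).Homotopic (Map.id (stdPullback f ι))

/-- An abstract sectional category on well-pointed spaces. (Its values on maps between spaces that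
are not well-pointed are unconstrained and never used.) -/
structure SectionalCategory where
  /-- the sectional category of a map -/
  secat : ∀ {A Y : PtSpace.{u}}, Map A Y → ℕ∞
  /-- S0: `secat ι = 0` iff `ι` has a homotopy section. -/
  S0 : ∀ {A Y : PtSpace.{u}}, A.WellPointed → Y.WellPointed → ∀ ι : Map A Y,
    (secat ι = 0 ↔ ∃ s : Map Y A, (ι.comp s).Homotopic (Map.id Y))
  /-- S1: if `κ ≃ ι ∘ ζ` then `secat ι ≤ secat κ`. -/
  S1 : ∀ {A B X : PtSpace.{u}}, A.WellPointed → B.WellPointed → X.WellPointed →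
    ∀ (ι : Map A X) (κ : Map B X) (ζ : Map B A), (ι.comp ζ).Homotopic κ → secat ι ≤ secat κ
  /-- S2: `secat` does not increase under homotopy pullback. -/
  S2 : ∀ {P X A Y : PtSpace.{u}}, P.WellPointed → X.WellPointed → A.WellPointed →
    Y.WellPointed → ∀ (q : Map P X) (p : Map P A) (f : Map X Y) (ι : Map A Y),
    IsHomotopyPullback q p f ι → secat q ≤ secat ι

namespace SectionalCategory

variable (S : SectionalCategory.{u}) {X Y A : PtSpace.{u}}

/-- The lifting category from `f` to `ι`: the sectional category of `q : P → X`, where `P` is a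
well-pointed homotopy pullback of `f` and `ι`; by S1 all choices of `P` give the same value. -/
noncomputable def liftcat (f : Map X Y) (ι : Map A Y) : ℕ∞ :=
  sInf {m | ∃ (P : PtSpace.{u}) (_ : P.WellPointed) (q : Map P X) (p : Map P A),
    IsHomotopyPullback q p f ι ∧ S.secat q = m}

/-- The homotopic distance `D(f, g)`. -/
noncomputable def dist (f g : Map X Y) : ℕ∞ := S.liftcat (Map.pair f g) (diag Y)

/-- The topological complexity. -/
noncomputable def TC (Y : PtSpace.{u}) : ℕ∞ := S.secat (diag Y)

/-- The category of a map. -/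
noncomputable def catMap (f : Map X Y) : ℕ∞ := S.liftcat f (const point Y)

/-- The LS category of a space. -/
noncomputable def cat (Y : PtSpace.{u}) : ℕ∞ := S.catMap (Map.id Y)

end SectionalCategory

/-! The version with open covers; every open set of a cover contains the basepoint. -/

section OpenCovers

variable {X Y A : PtSpace.{u}}

/-- There is a categorical open cover of `X` by `n + 1` open sets for `f` and `ι`. -/
def HasCatCover (f : Map X Y) (ι : Map A Y) (n : ℕ) : Prop :=
  ∃ (U : Fin (n + 1) → Set X) (hU : ∀ i, X.pt ∈ U i),
    (∀ i, IsOpen (U i)) ∧ (∀ x, ∃ i, x ∈ U i) ∧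
    ∀ i, ∃ l : Map (X.sub (U i) (hU i)) A, (ι.comp l).Homotopic (f.restrict (U i) (hU i))

/-- The lifting category with open covers. -/
noncomputable def liftcatOp (f : Map X Y) (ι : Map A Y) : ℕ∞ :=
  sInf {m | ∃ n : ℕ, HasCatCover f ι n ∧ (n : ℕ∞) = m}

/-- The sectional category with open covers. -/
noncomputable def secatOp (ι : Map A Y) : ℕ∞ := liftcatOp (Map.id Y) ι

/-- The homotopic distance with open covers. -/
noncomputable def distOp (f g : Map X Y) : ℕ∞ := liftcatOp (Map.pair f g) (diag Y)

/-- The topological complexity with open covers. -/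
noncomputable def TCOp (Y : PtSpace.{u}) : ℕ∞ := secatOp (diag Y)

/-- The LS category with open covers. -/
noncomputable def catOp (Y : PtSpace.{u}) : ℕ∞ := liftcatOp (Map.id Y) (const point Y)

end OpenCovers

end PtSpace

/-! Everything is reduced to one relation, `LiftsAlong f ι κ`: the composite `f ∘ κ` lifts through
`ι` up to homotopy. A homotopy pullback `q` satisfies it, and every `κ` satisfying it factors
through the standard homotopy pullback. By S1, if lifting `f'` through `ι'` along `κ` always forces
lifting `f` through `ι` along `κ`, then `liftcat f ι ≤ liftcat f' ι'`. For open covers the same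
holds, with `κ` the inclusions of the open sets.

Now `(id, n) ∘ κ = (κ, const)` lifts through the diagonal iff some `l` has `l ≃ κ` and `l ≃ const`,
i.e. iff `κ` is null-homotopic, i.e. iff `κ` lifts through a point. So `D(id, n) = cat`. S2 (for
covers, taking preimages) gives `D(id, n) ≤ TC`. A null-homotopic map to `X × X` is homotopic to a
constant on the diagonal, so it lifts through the diagonal and `TC(X) ≤ cat(X × X)`.

In the pointed setting S1 and S2 may be applied to a standard pullback only if it is well-pointed.
This is checked for the two pullbacks needed, by constructing retractions of their cylinders. -/

namespace UnptLift

/-! ### Unpointed lifting criterion -/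

section Lifts

variable {X Y A B : Type u} [TopologicalSpace X] [TopologicalSpace Y] [TopologicalSpace A]
  [TopologicalSpace B]

/-- The composite `f ∘ κ` lifts through `ι` up to homotopy. -/
def LiftsAlong (f : C(X, Y)) (ι : C(A, Y)) (κ : C(B, X)) : Prop :=
  ∃ l : C(B, A), (ι.comp l).Homotopic (f.comp κ)

/-- The projection of the standard homotopy pullback to the source of `f`. -/
def StdPullback.proj (f : C(X, Y)) (ι : C(A, Y)) : C(StdPullback f ι, X) :=
  ⟨fun w => w.1.1, by fun_prop⟩

/-- The projection of the standard homotopy pullback to the source of `ι`. -/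
def StdPullback.coproj (f : C(X, Y)) (ι : C(A, Y)) : C(StdPullback f ι, A) :=
  ⟨fun w => w.1.2.2, by fun_prop⟩

/-- The standard homotopy pullback is a homotopy pullback. -/
theorem isHomotopyPullback_stdPullback (f : C(X, Y)) (ι : C(A, Y)) :
    IsHomotopyPullback (StdPullback.proj f ι) (StdPullback.coproj f ι) f ι :=
  ⟨ContinuousMap.id _, fun _ => rfl, fun _ => rfl, ContinuousMap.id _, .refl _, .refl _⟩

/-- A homotopy pullback square commutes up to homotopy. -/
theorem IsHomotopyPullback.liftsAlong {q : C(B, X)} {p : C(B, A)} {f : C(X, Y)} {ι : C(A, Y)}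
    (h : IsHomotopyPullback q p f ι) : LiftsAlong f ι q := by
  obtain ⟨w, hq, hp, -⟩ := h
  refine ⟨p, ContinuousMap.Homotopic.symm ⟨⟨⟨fun z => (w z.2).1.2.1 z.1, ?_⟩, ?_, ?_⟩⟩⟩
  · fun_prop
  · intro z
    simp [(w z).2.1, hq]
  · intro z
    simp [(w z).2.2, hp]

/-- A map along which `f` lifts through `ι` factors through the standard homotopy pullback. -/
theorem LiftsAlong.exists_factor {f : C(X, Y)} {ι : C(A, Y)} {κ : C(B, X)}
    (h : LiftsAlong f ι κ) : ∃ ζ : C(B, StdPullback f ι), (StdPullback.proj f ι).comp ζ = κ := by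
  obtain ⟨l, hl⟩ := h
  obtain ⟨F⟩ := hl.symm
  let G : C(B, C(I, Y)) := (F.toContinuousMap.comp ContinuousMap.prodSwap).curry
  refine ⟨⟨fun b => ⟨(κ b, G b, l b), F.apply_zero b, F.apply_one b⟩, ?_⟩, rfl⟩
  fun_prop

/-- If `f'` lifts through `ι'` only where `f` lifts through `ι`, then
`liftcat f ι ≤ liftcat f' ι'`. -/
theorem SectionalCategory.liftcat_mono (S : SectionalCategory.{u}) [Nonempty X] {Y' A' : Type u}
    [TopologicalSpace Y'] [TopologicalSpace A'] {f : C(X, Y)} {ι : C(A, Y)} {f' : C(X, Y')}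
    {ι' : C(A', Y')} (h : ∀ {B : Type u} [TopologicalSpace B] (κ : C(B, X)),
      LiftsAlong f' ι' κ → LiftsAlong f ι κ) : S.liftcat f ι ≤ S.liftcat f' ι' := by
  refine le_sInf ?_
  rintro _ ⟨P, _, ⟨z⟩, q, p, hP, rfl⟩
  obtain ⟨ζ, hζ⟩ := (h q hP.liftsAlong).exists_factor
  have hS : Nonempty (StdPullback f ι) := ⟨ζ z⟩
  have : Nonempty P := ⟨z⟩
  -- The standard pullback is one competitor in the infimum, and S1 along `ζ` compares it with the
  -- arbitrary pullback `P`.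
  refine le_trans (sInf_le ⟨_, _, hS, _, _, isHomotopyPullback_stdPullback f ι, rfl⟩) ?_
  exact S.S1 _ _ ζ (hζ ▸ .refl _)

/-- The lifting category is bounded by the sectional category. -/
theorem SectionalCategory.liftcat_le_secat (S : SectionalCategory.{u}) [Nonempty X] [Nonempty A]
    [Nonempty Y] (f : C(X, Y)) (ι : C(A, Y)) [hP : Nonempty (StdPullback f ι)] :
    S.liftcat f ι ≤ S.secat ι :=
  le_trans (sInf_le ⟨_, _, hP, _, _, isHomotopyPullback_stdPullback f ι, rfl⟩)
    (S.S2 _ _ _ _ (isHomotopyPullback_stdPullback f ι))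

/-- If `ι` has a homotopy section wherever `f'` lifts through `ι'`, then
`secat ι ≤ liftcat f' ι'`. -/
theorem SectionalCategory.secat_le_liftcat (S : SectionalCategory.{u}) [Nonempty X] [Nonempty A]
    {Y' A' : Type u} [TopologicalSpace Y'] [TopologicalSpace A'] {ι : C(A, X)} {f' : C(X, Y')}
    {ι' : C(A', Y')} (h : ∀ {B : Type u} [TopologicalSpace B] (κ : C(B, X)),
      LiftsAlong f' ι' κ → LiftsAlong (ContinuousMap.id X) ι κ) :
    S.secat ι ≤ S.liftcat f' ι' := by
  refine le_sInf ?_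
  rintro _ ⟨P, _, _, q, p, hP, rfl⟩
  obtain ⟨l, hl⟩ := h q hP.liftsAlong
  -- Here `hl` reads `ι ∘ l ≃ id ∘ q`, and `id ∘ q` is `q` definitionally, so no pullback of `ι` is
  -- needed.
  exact S.S1 _ _ l hl

/-- If `f'` lifts through `ι'` only where `f` lifts through `ι`, then
`liftcatOp f ι ≤ liftcatOp f' ι'`. -/
theorem liftcatOp_mono {Y' A' : Type u} [TopologicalSpace Y'] [TopologicalSpace A'] {f : C(X, Y)}
    {ι : C(A, Y)} {f' : C(X, Y')} {ι' : C(A', Y')}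
    (h : ∀ {B : Type u} [TopologicalSpace B] (κ : C(B, X)),
      LiftsAlong f' ι' κ → LiftsAlong f ι κ) : liftcatOp f ι ≤ liftcatOp f' ι' := by
  refine le_sInf ?_
  rintro _ ⟨n, ⟨U, hU, hc, hl⟩, rfl⟩
  -- Restricting to `U i` is composing with its inclusion, so the hypothesis applies with that
  -- inclusion as `κ`.
  exact sInf_le ⟨n, ⟨U, hU, hc, fun i => h ⟨Subtype.val, continuous_subtype_val⟩ (hl i)⟩, rfl⟩

/-- The lifting category with open covers is bounded by the sectional category. -/
theorem liftcatOp_le_secatOp (f : C(X, Y)) (ι : C(A, Y)) : liftcatOp f ι ≤ secatOp ι := by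
  refine le_sInf ?_
  rintro _ ⟨n, ⟨U, hU, hc, hl⟩, rfl⟩
  refine sInf_le ⟨n, ⟨fun i => f ⁻¹' U i, fun i => (hU i).preimage f.continuous,
    fun x => hc (f x), fun i => ?_⟩, rfl⟩
  obtain ⟨l, hl⟩ := hl i
  exact ⟨l.comp (f.restrictPreimage (U i)),
    hl.comp (ContinuousMap.Homotopic.refl (f.restrictPreimage (U i)))⟩

theorem liftsAlong_pointMap_iff {κ : C(B, X)} {x₀ : X} :
    LiftsAlong (ContinuousMap.id X) (pointMap x₀) κ ↔ κ.Homotopic (ContinuousMap.const B x₀) :=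
  ⟨fun ⟨_, hl⟩ => hl.symm, fun h => ⟨ContinuousMap.const B PUnit.unit, h.symm⟩⟩

end Lifts

/-! ### Null-homotopic maps and the diagonal -/

section PathConnected

variable {X B : Type u} [TopologicalSpace X] [PathConnectedSpace X] [TopologicalSpace B]

theorem homotopic_const_const (x y : X) :
    (ContinuousMap.const B x).Homotopic (ContinuousMap.const B y) := by
  obtain ⟨γ⟩ := PathConnectedSpace.joined x y
  exact ⟨⟨⟨fun z => γ z.1, by fun_prop⟩, by simp, by simp⟩⟩

/-- Along `κ`, the map `(id, n)` with `n` constant lifts through the diagonal iff `κ` is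
null-homotopic. -/
theorem liftsAlong_diag_iff_liftsAlong_pointMap {κ : C(B, X)} (x₀ x₁ : X) :
    LiftsAlong ((ContinuousMap.id X).prodMk (ContinuousMap.const X x₁)) (diag X) κ ↔
      LiftsAlong (ContinuousMap.id X) (pointMap x₀) κ := by
  rw [liftsAlong_pointMap_iff]
  constructor
  · rintro ⟨l, hl⟩
    -- The homotopy `(l, l) ≃ (κ, const)` is projected to each factor.
    have h₁ : l.Homotopic κ := (ContinuousMap.Homotopic.refl ContinuousMap.fst).comp hl
    have h₂ : l.Homotopic (ContinuousMap.const B x₁) :=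
      (ContinuousMap.Homotopic.refl ContinuousMap.snd).comp hl
    exact (h₁.symm.trans h₂).trans (homotopic_const_const _ _)
  · intro h
    exact ⟨ContinuousMap.const B x₁,
      ((homotopic_const_const x₁ x₀).trans h.symm).prodMk (.refl (ContinuousMap.const B x₁))⟩

/-- A null-homotopic map to `X × X` lifts through the diagonal. -/
theorem LiftsAlong.diag_of_pointMap {κ : C(B, X × X)} {z₀ : X × X}
    (h : LiftsAlong (ContinuousMap.id (X × X)) (pointMap z₀) κ) :
    LiftsAlong (ContinuousMap.id (X × X)) (diag X) κ :=
  -- The point `z₀` need not lie on the diagonal; a path in `X × X` joins it to `(z₀.1, z₀.1)`.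
  ⟨ContinuousMap.const B z₀.1,
    (homotopic_const_const (z₀.1, z₀.1) z₀).trans (liftsAlong_pointMap_iff.1 h).symm⟩

end PathConnected

end UnptLift

namespace PtSpace

/-! ### Calculus of pointed homotopies -/

section Homotopy

variable {X Y Z W : PtSpace.{u}}

theorem Map.Homotopic.refl (f : Map X Y) : f.Homotopic f :=
  ContinuousMap.HomotopicRel.refl _

theorem Map.Homotopic.symm {f g : Map X Y} (h : f.Homotopic g) : g.Homotopic f :=
  ContinuousMap.HomotopicRel.symm h

theorem Map.Homotopic.trans {f g k : Map X Y} (h : f.Homotopic g) (h' : g.Homotopic k) :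
    f.Homotopic k :=
  ContinuousMap.HomotopicRel.trans h h'

theorem Map.Homotopic.postcomp {f g : Map X Y} (h : f.Homotopic g) (k : Map Y Z) :
    (k.comp f).Homotopic (k.comp g) :=
  ContinuousMap.HomotopicRel.comp_continuousMap h k.toCont

theorem Map.Homotopic.precomp {f g : Map Y Z} (h : f.Homotopic g) (k : Map X Y) :
    (f.comp k).Homotopic (g.comp k) := by
  obtain ⟨F⟩ := h
  refine ⟨⟨F.toHomotopy.compContinuousMap k.toCont, ?_⟩⟩
  rintro t x rfl
  exact F.eq_fst t k.map_pt

theorem Map.Homotopic.pair {f f' : Map X Y} {g g' : Map X Z} (hf : f.Homotopic f')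
    (hg : g.Homotopic g') : (Map.pair f g).Homotopic (Map.pair f' g') := by
  obtain ⟨F⟩ := hf
  obtain ⟨G⟩ := hg
  exact ⟨F.prod G⟩

/-- The first projection of a product. -/
def Map.fst (Y Z : PtSpace.{u}) : Map (Y.prod Z) Y := ⟨ContinuousMap.fst, rfl⟩

/-- The second projection of a product. -/
def Map.snd (Y Z : PtSpace.{u}) : Map (Y.prod Z) Z := ⟨ContinuousMap.snd, rfl⟩

end Homotopy

/-! ### Well-pointedness through cylinder retractions -/

section Retract

/-- A retraction of `I × X` onto `{0} × X ∪ I × {pt}`, given by its coordinates. -/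
structure CylinderRetraction (X : PtSpace.{u}) where
  /-- the coordinate in `X` -/
  pos : C(I × X, X)
  /-- the coordinate in `I` -/
  time : C(I × X, I)
  pos_zero : ∀ x, pos (0, x) = x
  time_zero : ∀ x, time (0, x) = 0
  pos_pt : ∀ t, pos (t, X.pt) = X.pt
  time_pt : ∀ t, time (t, X.pt) = t
  time_eq_zero_or : ∀ z, time z = 0 ∨ pos z = X.pt

variable {X Y A : PtSpace.{u}}

/-- The universal instance of homotopy extension: the target is `{0} × X ∪ I × {pt}` itself, and
extending its two inclusions yields the retraction. -/
theorem WellPointed.nonempty_cylinderRetraction (h : X.WellPointed) :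
    Nonempty (CylinderRetraction X) := by
  obtain ⟨H, h₀, h₁⟩ := h.2 {z : X × I // z.2 = 0 ∨ z.1 = X.pt}
    ⟨fun x => ⟨(x, 0), .inl rfl⟩, by fun_prop⟩
    ⟨fun t => ⟨(X.pt, t), .inr rfl⟩, by fun_prop⟩ rfl
  exact ⟨{
    pos := ⟨fun z => (H z).1.1, by fun_prop⟩
    time := ⟨fun z => (H z).1.2, by fun_prop⟩
    pos_zero := fun x => by simp [h₀]
    time_zero := fun x => by simp [h₀]
    pos_pt := fun t => by simp [h₁]
    time_pt := fun t => by simp [h₁]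
    time_eq_zero_or := fun z => (H z).2 }⟩

/-- Follow the retraction by `f` on the bottom and by `γ` on the basepoint line. The two pieces
agree where they meet and have closed preimages because the basepoint is closed, so they glue. -/
theorem CylinderRetraction.wellPointed (r : CylinderRetraction X)
    (hc : IsClosed ({X.pt} : Set X)) : X.WellPointed := by
  classical
  refine ⟨hc, fun Z _ f γ hγ => ?_⟩
  have hs : IsClosed {z : I × X | r.time z = 0} := isClosed_eq r.time.continuous continuous_const
  have ht : IsClosed {z : I × X | r.pos z = X.pt} := hc.preimage r.pos.continuous
  let G : I × X → Z := fun z => if r.time z = 0 then f (r.pos z) else γ (r.time z)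
  have hG₁ : ∀ z, r.time z = 0 → G z = f (r.pos z) := fun z hz => if_pos hz
  have hG₂ : ∀ z, r.pos z = X.pt → G z = γ (r.time z) := by
    intro z hz
    by_cases h : r.time z = 0
    · rw [hG₁ z h, hz, h, hγ]
    · exact if_neg h
  have hG : Continuous G := by
    rw [← continuousOn_univ,
      ← Set.eq_univ_of_forall (s := {z | r.time z = 0} ∪ {z | r.pos z = X.pt}) r.time_eq_zero_or]
    refine ContinuousOn.union_of_isClosed ?_ ?_ hs ht
    · exact ContinuousOn.congr (f := fun z => f (r.pos z)) (by fun_prop) hG₁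
    · exact ContinuousOn.congr (f := fun z => γ (r.time z)) (by fun_prop) hG₂
  refine ⟨⟨G, hG⟩, fun x => ?_, fun t => ?_⟩
  · exact (hG₁ _ (r.time_zero x)).trans (by rw [r.pos_zero])
  · exact (hG₂ _ (r.pos_pt t)).trans (by rw [r.time_pt])

/-- The retraction for a product, taking the smaller time coordinate. -/
def CylinderRetraction.prod (r : CylinderRetraction X) (s : CylinderRetraction Y) :
    CylinderRetraction (X.prod Y) where
  pos := ⟨fun z => (r.pos (z.1, z.2.1), s.pos (z.1, z.2.2)), by
    refine Continuous.prodMk ?_ ?_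
    · exact r.pos.continuous.comp (continuous_fst.prodMk (continuous_fst.comp continuous_snd))
    · exact s.pos.continuous.comp (continuous_fst.prodMk (continuous_snd.comp continuous_snd))⟩
  time := ⟨fun z => min (r.time (z.1, z.2.1)) (s.time (z.1, z.2.2)), by
    refine Continuous.min ?_ ?_
    · exact r.time.continuous.comp (continuous_fst.prodMk (continuous_fst.comp continuous_snd))
    · exact s.time.continuous.comp (continuous_fst.prodMk (continuous_snd.comp continuous_snd))⟩
  pos_zero x := Prod.ext (r.pos_zero _) (s.pos_zero _)
  time_zero x := by simp [r.time_zero, s.time_zero]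
  pos_pt t := Prod.ext (r.pos_pt _) (s.pos_pt _)
  time_pt t := (congrArg₂ min (r.time_pt t) (s.time_pt t)).trans (min_self t)
  time_eq_zero_or z := by
    rcases r.time_eq_zero_or (z.1, z.2.1) with h | h
    · exact .inl ((congrArg (min · _) h).trans (min_eq_left unitInterval.nonneg'))
    rcases s.time_eq_zero_or (z.1, z.2.2) with h' | h'
    · exact .inl ((congrArg (min _ ·) h').trans (min_eq_right unitInterval.nonneg'))
    · exact .inr (Prod.ext h h')

theorem isClosed_pt_prod (hX : IsClosed ({X.pt} : Set X)) (hY : IsClosed ({Y.pt} : Set Y)) :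
    IsClosed ({(X.prod Y).pt} : Set (X.prod Y)) := by
  have h := hX.prod hY
  rwa [Set.singleton_prod_singleton] at h

theorem WellPointed.prod (hX : X.WellPointed) (hY : Y.WellPointed) : (X.prod Y).WellPointed := by
  obtain ⟨r⟩ := hX.nonempty_cylinderRetraction
  obtain ⟨s⟩ := hY.nonempty_cylinderRetraction
  exact (r.prod s).wellPointed (isClosed_pt_prod hX.1 hY.1)

/-- The retraction for the one-point space. -/
def CylinderRetraction.point : CylinderRetraction point.{u} where
  pos := ContinuousMap.snd
  time := ContinuousMap.fst
  pos_zero _ := rfl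
  time_zero _ := rfl
  pos_pt _ := rfl
  time_pt _ := rfl
  time_eq_zero_or _ := .inr rfl

theorem isClosed_pt_point : IsClosed ({point.{u}.pt} : Set point.{u}) := by
  convert isClosed_univ (X := point.{u})
  exact Set.eq_univ_of_forall fun _ => rfl

/-- The infimum of the time coordinate along a path depends continuously on the path. -/
theorem CylinderRetraction.continuous_sInf_time (r : CylinderRetraction Y) :
    Continuous fun z : I × C(I, Y) => sInf ((fun s : I => r.time (z.1, z.2 s)) '' Set.univ) := by
  refine isCompact_univ.continuous_sInf ?_
  change Continuous fun z : (I × C(I, Y)) × I => r.time (z.1.1, z.1.2 z.2)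
  fun_prop

/-- Cylinder retractions whose space coordinates commute with `f` and `ι` induce one on the
standard homotopy pullback. Its time coordinate is the smallest one along the path. -/
noncomputable def CylinderRetraction.stdPullback {f : Map X Y} {ι : Map A Y}
    (r : CylinderRetraction X) (s : CylinderRetraction A) (k : CylinderRetraction Y)
    (hf : ∀ t x, k.pos (t, f.toCont x) = f.toCont (r.pos (t, x)))
    (hι : ∀ t a, k.pos (t, ι.toCont a) = ι.toCont (s.pos (t, a))) :
    CylinderRetraction (PtSpace.stdPullback f ι) where
  pos :=
    -- The path is moved pointwise by `k`; `hf` and `hι` ensure that its ends still match the moved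
    -- points of `X` and `A`.
    let G : C(I × UnptLift.StdPullback f.toCont ι.toCont, C(I, Y)) :=
      ContinuousMap.curry ⟨fun z => k.pos (z.1.1, z.1.2.1.2.1 z.2), by fun_prop⟩
    ⟨fun z => ⟨(r.pos (z.1, z.2.1.1), G z, s.pos (z.1, z.2.1.2.2)),
      by
        change k.pos (z.1, z.2.1.2.1 0) = _
        rw [z.2.2.1, hf],
      by
        change k.pos (z.1, z.2.1.2.1 1) = _
        rw [z.2.2.2, hι]⟩, by
      change Continuous fun z : I × UnptLift.StdPullback f.toCont ι.toCont => _
      fun_prop⟩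
  -- The minimum vanishes as soon as one point of the triple has time zero. Otherwise all of them
  -- are at basepoints, so the moved triple is the basepoint.
  time := ⟨fun z => min (min (r.time (z.1, z.2.1.1)) (s.time (z.1, z.2.1.2.2)))
      (sInf ((fun s : I => k.time (z.1, z.2.1.2.1 s)) '' Set.univ)), by
    have h := k.continuous_sInf_time
    change Continuous fun z : I × UnptLift.StdPullback f.toCont ι.toCont => _
    refine Continuous.min (by fun_prop) ?_
    exact h.comp (f := fun z : I × UnptLift.StdPullback f.toCont ι.toCont => (z.1, z.2.1.2.1))
      (by fun_prop)⟩
  pos_zero x := Subtype.ext (Prod.ext (r.pos_zero _)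
    (Prod.ext (ContinuousMap.ext fun _ => k.pos_zero _) (s.pos_zero _)))
  time_zero x := by
    refine le_antisymm ?_ unitInterval.nonneg'
    exact (min_le_left _ _).trans ((min_le_left _ _).trans (r.time_zero _).le)
  pos_pt t := Subtype.ext (Prod.ext (r.pos_pt _)
    (Prod.ext (ContinuousMap.ext fun _ => k.pos_pt _) (s.pos_pt _)))
  time_pt t := by
    have h : (fun _ : I => k.time (t, Y.pt)) '' Set.univ = {t} := by
      rw [k.time_pt]
      exact Set.univ_nonempty.image_const t
    refine (congrArg₂ min (congrArg₂ min (r.time_pt t) (s.time_pt t)) (congrArg sInf h)).trans ?_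
    simp
  time_eq_zero_or z := by
    have hmin : ∀ {a b : I}, a = 0 ∨ b = 0 → min a b = 0 := by
      rintro a b (rfl | rfl)
      · exact min_eq_left unitInterval.nonneg'
      · exact min_eq_right unitInterval.nonneg'
    rcases r.time_eq_zero_or (z.1, z.2.1.1) with h | h
    · exact .inl (hmin (.inl (hmin (.inl h))))
    rcases s.time_eq_zero_or (z.1, z.2.1.2.2) with h' | h'
    · exact .inl (hmin (.inl (hmin (.inr h'))))
    by_cases hk : ∃ τ : I, k.time (z.1, z.2.1.2.1 τ) = 0
    · obtain ⟨τ, hτ⟩ := hk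
      refine .inl (hmin (.inr (le_antisymm ?_ unitInterval.nonneg')))
      exact sInf_le ⟨τ, Set.mem_univ _, hτ⟩
    · push Not at hk
      refine .inr (Subtype.ext (Prod.ext h (Prod.ext (ContinuousMap.ext fun τ => ?_) h')))
      exact (k.time_eq_zero_or _).resolve_left (hk τ)

/-- Evaluation at each `τ` is continuous, so being the constant path at the basepoint is an
intersection of closed conditions. -/
theorem isClosed_pt_stdPullback {f : Map X Y} {ι : Map A Y} (hX : IsClosed ({X.pt} : Set X))
    (hA : IsClosed ({A.pt} : Set A)) (hY : IsClosed ({Y.pt} : Set Y)) :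
    IsClosed ({(stdPullback f ι).pt} : Set (stdPullback f ι)) := by
  let P := UnptLift.StdPullback f.toCont ι.toCont
  have h : IsClosed ({w : P | w.1.1 = X.pt} ∩ {w : P | w.1.2.2 = A.pt} ∩
      ⋂ τ : I, {w : P | w.1.2.1 τ = Y.pt}) := by
    refine IsClosed.inter (IsClosed.inter ?_ ?_) (isClosed_iInter fun τ => ?_)
    · exact hX.preimage (f := fun w : P => w.1.1) (by fun_prop)
    · exact hA.preimage (f := fun w : P => w.1.2.2) (by fun_prop)
    · exact hY.preimage (f := fun w : P => w.1.2.1 τ) (by fun_prop)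
  refine (congrArg (IsClosed (X := P)) (Set.ext fun w => ?_)).mpr h
  simp only [Set.mem_inter_iff, Set.mem_iInter]
  constructor
  · rintro rfl
    exact ⟨⟨rfl, rfl⟩, fun _ => rfl⟩
  · rintro ⟨⟨h₁, h₂⟩, h₃⟩
    exact Subtype.ext (Prod.ext h₁ (Prod.ext (ContinuousMap.ext h₃) h₂))

theorem WellPointed.stdPullback_point (h : X.WellPointed) :
    (stdPullback (Map.id X) (const point X)).WellPointed := by
  obtain ⟨r⟩ := h.nonempty_cylinderRetraction
  exact (CylinderRetraction.stdPullback (f := Map.id X) (ι := const point X) r .point r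
    (fun _ _ => rfl) (fun t _ => r.pos_pt t)).wellPointed
      (isClosed_pt_stdPullback h.1 isClosed_pt_point h.1)

/-- The product retraction `r.prod r` on `X × X` commutes with both maps: its space coordinate fixes
the basepoint in the second factor and preserves the diagonal. -/
theorem WellPointed.stdPullback_diag (h : X.WellPointed) :
    (stdPullback (Map.pair (Map.id X) (const X X)) (diag X)).WellPointed := by
  obtain ⟨r⟩ := h.nonempty_cylinderRetraction
  exact (CylinderRetraction.stdPullback (f := Map.pair (Map.id X) (const X X)) (ι := diag X) r r
    (r.prod r) (fun t _ => Prod.ext rfl (r.pos_pt t)) (fun _ _ => rfl)).wellPointed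
      (isClosed_pt_stdPullback h.1 h.1 (isClosed_pt_prod h.1 h.1))

end Retract

/-! ### Pointed lifting criterion -/

section Lifts

variable {X Y A B Y' A' : PtSpace.{u}}

/-- The composite `f ∘ κ` lifts through `ι` up to pointed homotopy. -/
def LiftsAlong (f : Map X Y) (ι : Map A Y) (κ : Map B X) : Prop :=
  ∃ l : Map B A, (ι.comp l).Homotopic (f.comp κ)

/-- The projection of the standard homotopy pullback to the source of `f`. -/
def stdProj (f : Map X Y) (ι : Map A Y) : Map (stdPullback f ι) X :=
  ⟨UnptLift.StdPullback.proj f.toCont ι.toCont, rfl⟩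

/-- The projection of the standard homotopy pullback to the source of `ι`. -/
def stdCoproj (f : Map X Y) (ι : Map A Y) : Map (stdPullback f ι) A :=
  ⟨UnptLift.StdPullback.coproj f.toCont ι.toCont, rfl⟩

/-- The standard homotopy pullback is a homotopy pullback. -/
theorem isHomotopyPullback_stdPullback (f : Map X Y) (ι : Map A Y) :
    IsHomotopyPullback (stdProj f ι) (stdCoproj f ι) f ι :=
  ⟨Map.id _, fun _ => rfl, fun _ => rfl, Map.id _, .refl _, .refl _⟩

/-- A homotopy pullback square commutes up to homotopy. -/
theorem IsHomotopyPullback.liftsAlong {q : Map B X} {p : Map B A} {f : Map X Y} {ι : Map A Y}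
    (h : IsHomotopyPullback q p f ι) : LiftsAlong f ι q := by
  obtain ⟨w, hq, hp, -⟩ := h
  have hw : Continuous fun z => (w.toCont z : UnptLift.StdPullback f.toCont ι.toCont) :=
    w.toCont.continuous
  refine ⟨p, Map.Homotopic.symm ⟨⟨⟨⟨fun z => (w.toCont z.2).1.2.1 z.1, ?_⟩, ?_, ?_⟩, ?_⟩⟩⟩
  · fun_prop
  · intro z
    exact (w.toCont z).2.1.trans (congrArg f.toCont (hq z))
  · intro z
    exact (w.toCont z).2.2.trans (congrArg ι.toCont (hp z))
  -- Since `w` is pointed, it sends the basepoint to the constant path, so the homotopy is relative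
  -- to the basepoint.
  · rintro t z rfl
    refine (congrArg (fun v : UnptLift.StdPullback f.toCont ι.toCont => v.1.2.1 t) w.map_pt).trans ?_
    exact (f.comp q).map_pt.symm

/-- A map along which `f` lifts through `ι` factors through the standard homotopy pullback. -/
theorem LiftsAlong.exists_factor {f : Map X Y} {ι : Map A Y} {κ : Map B X}
    (h : LiftsAlong f ι κ) : ∃ ζ : Map B (stdPullback f ι), (stdProj f ι).comp ζ = κ := by
  obtain ⟨l, hl⟩ := h
  obtain ⟨F⟩ := hl.symm
  let G : C(B, C(I, Y)) := (F.toContinuousMap.comp ContinuousMap.prodSwap).curry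
  let ζ : C(B, UnptLift.StdPullback f.toCont ι.toCont) :=
    ⟨fun b => ⟨(κ.toCont b, G b, l.toCont b), F.apply_zero b, F.apply_one b⟩, by fun_prop⟩
  refine ⟨⟨ζ, Subtype.ext (Prod.ext κ.map_pt (Prod.ext (ContinuousMap.ext fun t => ?_)
    l.map_pt))⟩, rfl⟩
  -- A pointed homotopy is stationary at the basepoint, which makes the path there constant.
  exact (F.eq_fst t rfl).trans (f.comp κ).map_pt

/-- If `f'` lifts through `ι'` only where `f` lifts through `ι`, then
`liftcat f ι ≤ liftcat f' ι'`. -/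
theorem SectionalCategory.liftcat_mono (S : SectionalCategory.{u}) {f : Map X Y} {ι : Map A Y}
    {f' : Map X Y'} {ι' : Map A' Y'} (hX : X.WellPointed) (hP : (stdPullback f ι).WellPointed)
    (h : ∀ {B : PtSpace.{u}} (κ : Map B X), LiftsAlong f' ι' κ → LiftsAlong f ι κ) :
    S.liftcat f ι ≤ S.liftcat f' ι' := by
  refine le_sInf ?_
  rintro _ ⟨Q, hQ, q, p, hq, rfl⟩
  obtain ⟨ζ, hζ⟩ := (h q hq.liftsAlong).exists_factor
  refine le_trans (sInf_le ⟨_, hP, _, _, isHomotopyPullback_stdPullback f ι, rfl⟩) ?_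
  exact S.S1 hP hQ hX _ _ ζ (hζ ▸ .refl _)

/-- The lifting category is bounded by the sectional category. -/
theorem SectionalCategory.liftcat_le_secat (S : SectionalCategory.{u}) (f : Map X Y)
    (ι : Map A Y) (hX : X.WellPointed) (hA : A.WellPointed) (hY : Y.WellPointed)
    (hP : (stdPullback f ι).WellPointed) : S.liftcat f ι ≤ S.secat ι :=
  le_trans (sInf_le ⟨_, hP, _, _, isHomotopyPullback_stdPullback f ι, rfl⟩)
    (S.S2 hP hX hA hY _ _ _ _ (isHomotopyPullback_stdPullback f ι))

/-- If `ι` has a homotopy section wherever `f'` lifts through `ι'`, then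
`secat ι ≤ liftcat f' ι'`. -/
theorem SectionalCategory.secat_le_liftcat (S : SectionalCategory.{u}) {ι : Map A X}
    {f' : Map X Y'} {ι' : Map A' Y'} (hX : X.WellPointed) (hA : A.WellPointed)
    (h : ∀ {B : PtSpace.{u}} (κ : Map B X),
      LiftsAlong f' ι' κ → LiftsAlong (Map.id X) ι κ) : S.secat ι ≤ S.liftcat f' ι' := by
  refine le_sInf ?_
  rintro _ ⟨P, hP, q, p, hq, rfl⟩
  obtain ⟨l, hl⟩ := h q hq.liftsAlong
  exact S.S1 hA hP hX _ _ l hl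

/-- If `f'` lifts through `ι'` only where `f` lifts through `ι`, then
`liftcatOp f ι ≤ liftcatOp f' ι'`. -/
theorem liftcatOp_mono {f : Map X Y} {ι : Map A Y} {f' : Map X Y'} {ι' : Map A' Y'}
    (h : ∀ {B : PtSpace.{u}} (κ : Map B X), LiftsAlong f' ι' κ → LiftsAlong f ι κ) :
    liftcatOp f ι ≤ liftcatOp f' ι' := by
  refine le_sInf ?_
  rintro _ ⟨n, ⟨U, hp, hU, hc, hl⟩, rfl⟩
  exact sInf_le ⟨n, ⟨U, hp, hU, hc, fun i => h ((Map.id X).restrict (U i) (hp i)) (hl i)⟩, rfl⟩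

/-- The lifting category with open covers is bounded by the sectional category. -/
theorem liftcatOp_le_secatOp (f : Map X Y) (ι : Map A Y) : liftcatOp f ι ≤ secatOp ι := by
  refine le_sInf ?_
  rintro _ ⟨n, ⟨U, hp, hU, hc, hl⟩, rfl⟩
  have hp' : ∀ i, X.pt ∈ f.toCont ⁻¹' U i := fun i => by
    rw [Set.mem_preimage, f.map_pt]
    exact hp i
  refine sInf_le ⟨n, ⟨fun i => f.toCont ⁻¹' U i, hp', fun i => (hU i).preimage f.toCont.continuous,
    fun x => hc (f.toCont x), fun i => ?_⟩, rfl⟩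
  obtain ⟨l, hl⟩ := hl i
  let g : Map (X.sub (f.toCont ⁻¹' U i) (hp' i)) (Y.sub (U i) (hp i)) :=
    ⟨f.toCont.restrictPreimage (U i), Subtype.ext f.map_pt⟩
  exact ⟨l.comp g, hl.precomp g⟩

/-- Any lift to the one-point space composes to the constant map definitionally. -/
theorem liftsAlong_const_point_iff {κ : Map B X} :
    LiftsAlong (Map.id X) (const point X) κ ↔ κ.Homotopic (const B X) :=
  ⟨fun ⟨_, hl⟩ => hl.symm, fun h => ⟨const B point, h.symm⟩⟩

/-- Along `κ`, the map `(id, const)` lifts through the diagonal iff `κ` is null-homotopic. -/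
theorem liftsAlong_diag_iff_liftsAlong_const_point {κ : Map B X} :
    LiftsAlong (Map.pair (Map.id X) (const X X)) (diag X) κ ↔
      LiftsAlong (Map.id X) (const point X) κ := by
  rw [liftsAlong_const_point_iff]
  constructor
  · rintro ⟨l, hl⟩
    have h₁ : l.Homotopic κ := hl.postcomp (Map.fst X X)
    have h₂ : l.Homotopic (const B X) := hl.postcomp (Map.snd X X)
    exact h₁.symm.trans h₂
  · intro h
    exact ⟨const B X, h.symm.pair (.refl (const B X))⟩

/-- A null-homotopic map to `X × X` lifts through the diagonal. -/
theorem LiftsAlong.diag_of_const_point {κ : Map B (X.prod X)}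
    (h : LiftsAlong (Map.id (X.prod X)) (const point (X.prod X)) κ) :
    LiftsAlong (Map.id (X.prod X)) (diag X) κ :=
  ⟨const B X, (liftsAlong_const_point_iff.1 h).symm⟩

end Lifts

end PtSpace

/-! ### The four versions of the theorem -/

theorem mainTheorem10 :
    -- unpointed spaces, any abstract sectional category
    (∀ (S : UnptLift.SectionalCategory.{u}) (X : Type u) [TopologicalSpace X]
        [PathConnectedSpace X] (n : C(X, X)) (_ : ∃ x₁, ∀ x, n x = x₁) (x₀ : X) (z₀ : X × X),
      S.dist (ContinuousMap.id X) n = S.cat X x₀ ∧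
      S.cat X x₀ ≤ S.TC X ∧
      S.TC X ≤ S.cat (X × X) z₀) ∧
    -- unpointed spaces, the version with open covers
    (∀ (X : Type u) [TopologicalSpace X] [PathConnectedSpace X] (n : C(X, X))
        (_ : ∃ x₁, ∀ x, n x = x₁) (x₀ : X) (z₀ : X × X),
      UnptLift.distOp (ContinuousMap.id X) n = UnptLift.catOp X x₀ ∧
      UnptLift.catOp X x₀ ≤ UnptLift.TCOp X ∧
      UnptLift.TCOp X ≤ UnptLift.catOp (X × X) z₀) ∧
    -- well-pointed spaces, any abstract sectional category
    (∀ (S : PtSpace.SectionalCategory.{u}) (X : PtSpace.{u}), X.WellPointed →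
      S.dist (PtSpace.Map.id X) (PtSpace.const X X) = S.cat X ∧
      S.cat X ≤ S.TC X ∧
      S.TC X ≤ S.cat (X.prod X)) ∧
    -- well-pointed spaces, the version with open covers
    (∀ X : PtSpace.{u}, X.WellPointed →
      PtSpace.distOp (PtSpace.Map.id X) (PtSpace.const X X) = PtSpace.catOp X ∧
      PtSpace.catOp X ≤ PtSpace.TCOp X ∧
      PtSpace.TCOp X ≤ PtSpace.catOp (X.prod X)) := by
  refine ⟨?_, ?_, ?_, ?_⟩
  · rintro S X _ _ n ⟨x₁, hn⟩ x₀ z₀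
    obtain rfl : n = ContinuousMap.const X x₁ := ContinuousMap.ext hn
    have hD : S.dist (ContinuousMap.id X) (ContinuousMap.const X x₁) = S.cat X x₀ :=
      le_antisymm
        (S.liftcat_mono fun _ => (UnptLift.liftsAlong_diag_iff_liftsAlong_pointMap x₀ x₁).2)
        (S.liftcat_mono fun _ => (UnptLift.liftsAlong_diag_iff_liftsAlong_pointMap x₀ x₁).1)
    refine ⟨hD, hD ▸ ?_, S.secat_le_liftcat fun _ => UnptLift.LiftsAlong.diag_of_pointMap⟩
    -- S2 requires a non-empty pullback; the constant path at `(x₁, x₁)` is a point of it.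
    have : Nonempty (UnptLift.StdPullback
        ((ContinuousMap.id X).prodMk (ContinuousMap.const X x₁)) (UnptLift.diag X)) :=
      ⟨⟨(x₁, ContinuousMap.const I (x₁, x₁), x₁), rfl, rfl⟩⟩
    exact S.liftcat_le_secat _ _
  · rintro X _ _ n ⟨x₁, hn⟩ x₀ z₀
    obtain rfl : n = ContinuousMap.const X x₁ := ContinuousMap.ext hn
    have hD : UnptLift.distOp (ContinuousMap.id X) (ContinuousMap.const X x₁) =
        UnptLift.catOp X x₀ :=
      le_antisymm
        (UnptLift.liftcatOp_mono fun _ =>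
          (UnptLift.liftsAlong_diag_iff_liftsAlong_pointMap x₀ x₁).2)
        (UnptLift.liftcatOp_mono fun _ =>
          (UnptLift.liftsAlong_diag_iff_liftsAlong_pointMap x₀ x₁).1)
    exact ⟨hD, hD ▸ UnptLift.liftcatOp_le_secatOp _ _,
      UnptLift.liftcatOp_mono fun _ => UnptLift.LiftsAlong.diag_of_pointMap⟩
  · intro S X hX
    have hD : S.dist (PtSpace.Map.id X) (PtSpace.const X X) = S.cat X :=
      le_antisymm
        (S.liftcat_mono hX hX.stdPullback_diag fun _ =>
          PtSpace.liftsAlong_diag_iff_liftsAlong_const_point.2)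
        (S.liftcat_mono hX hX.stdPullback_point fun _ =>
          PtSpace.liftsAlong_diag_iff_liftsAlong_const_point.1)
    exact ⟨hD, hD ▸ S.liftcat_le_secat _ _ hX hX (hX.prod hX) hX.stdPullback_diag,
      S.secat_le_liftcat (hX.prod hX) hX fun _ => PtSpace.LiftsAlong.diag_of_const_point⟩
  · intro X _
    have hD : PtSpace.distOp (PtSpace.Map.id X) (PtSpace.const X X) = PtSpace.catOp X :=
      le_antisymm
        (PtSpace.liftcatOp_mono fun _ => PtSpace.liftsAlong_diag_iff_liftsAlong_const_point.2)
        (PtSpace.liftcatOp_mono fun _ => PtSpace.liftsAlong_diag_iff_liftsAlong_const_point.1)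
    exact ⟨hD, hD ▸ PtSpace.liftcatOp_le_secatOp _ _,
      PtSpace.liftcatOp_mono fun _ => PtSpace.LiftsAlong.diag_of_const_point⟩
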